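/- Let $H$ be a complex Hilbert space with inner product $(\cdot,\cdot)$, let $L$ be a non-negative selfadjoint operator in $H$, in general unbounded, with $\ker L=\{0\}$, and let $G$ be a bounded non-negative selfadjoint operator on $H$ with $$\ker G=\{0\},\qquad \operatorname{ran} G\cap\operatorname{dom} L=\{0\}$$ (if $H\neq\{0\}$, this forces $L$ to be unbounded). For $z\in\mathbb C$ with $\operatorname{Re} z\ge 0$ let $$\Lambda(z):=L(I+zG)L,\qquad \operatorname{dom}\Lambda(z)=\{h\in\operatorname{dom}L:\ (I+zG)Lh\in\operatorname{dom}L\}.$$ Then: 1. For every $z$ with $\operatorname{Re} z\ge0$ the operator $\Lambda(z)$ is $m$-sectorial, i.e. it is densely defined, its numerical range $\{(\Lambda(z)u,u):u\in\operatorname{dom}\Lambda(z),\ \|u\|=1\}$ is contained in a sector $\{w\in\mathbb C:|\arg w|\le\alpha\}\cup\{0\}$ for some $\alpha\in[0,\pi/2)$ (which may depend on $z$), and $\operatorname{ran}(\Lambda(z)-\lambda I)=H$ for some $\lambda$ with $\operatorname{Re}\lambda<0$. 2. The family $\Lambda(z)$ is holomorphic of type (B) in the open right half-plane $\mathbb C_+=\{\operatorname{Re}z>0\}$,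 i.e. there are a dense subspace $D\subset H$ and sesquilinear forms $\mathfrak a(z)$, $z\in\mathbb C_+$, with domain $D$ such that each $\mathfrak a(z)$ is closed and sectorial (for some real vertex and some semi-angle less than $\pi/2$), $z\mapsto\mathfrak a(z)[u,u]$ is holomorphic in $\mathbb C_+$ for every $u\in D$, and $\Lambda(z)$ is the operator associated with $\mathfrak a(z)$: one has $u\in\operatorname{dom}\Lambda(z)$ and $\Lambda(z)u=w$ if and only if $u\in D$ and $\mathfrak a(z)[u,v]=(w,v)$ for all $v\in D$. 3. $\operatorname{dom}\Lambda(\xi)\cap\operatorname{dom}\Lambda(\mu)=\{0\}$ for all $\xi,\mu\in\mathbb C$ with $\operatorname{Re}\xi\ge0$, $\operatorname{Re}\mu\ge0$, $\xi\ne\mu$. 4. $\operatorname{dom}\Lambda(z)\cap\operatorname{dom}\Lambda(z)^*=\{0\}$ for all $z\in\mathbb C$ with $\operatorname{Re}z\ge0$, $\operatorname{Im}z\ne0$. -/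

import Mathlib

open scoped InnerProductSpace

namespace UnboundedOperator

variable {H : Type*} [NormedAddCommGroup H] [InnerProductSpace ℂ H]

/-- The product `S T` of two (unbounded) operators on its natural domain
`{x ∈ dom T : T x ∈ dom S}`. -/
def mul (S T : H →ₗ.[ℂ] H) : H →ₗ.[ℂ] H where
  domain :=
    { carrier := {x | ∃ h : x ∈ T.domain, T ⟨x, h⟩ ∈ S.domain}
      zero_mem' := ⟨T.domain.zero_mem, by
        have h : T ⟨0, T.domain.zero_mem⟩ = 0 := T.map_zero
        rw [h]; exact S.domain.zero_mem⟩
      add_mem' := by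
        rintro x y ⟨hx, hx'⟩ ⟨hy, hy'⟩
        refine ⟨T.domain.add_mem hx hy, ?_⟩
        have h : T ⟨x + y, T.domain.add_mem hx hy⟩ = T ⟨x, hx⟩ + T ⟨y, hy⟩ :=
          T.map_add ⟨x, hx⟩ ⟨y, hy⟩
        rw [h]; exact S.domain.add_mem hx' hy'
      smul_mem' := by
        rintro c x ⟨hx, hx'⟩
        refine ⟨T.domain.smul_mem c hx, ?_⟩
        have h : T ⟨c • x, T.domain.smul_mem c hx⟩ = c • T ⟨x, hx⟩ := T.map_smul c ⟨x, hx⟩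
        rw [h]; exact S.domain.smul_mem c hx' }
  toFun :=
    { toFun := fun x => S ⟨T ⟨x, x.2.1⟩, x.2.2⟩
      map_add' := fun x y => by
        rw [← S.map_add]
        exact congrArg S (Subtype.ext (T.map_add ⟨x, x.2.1⟩ ⟨y, y.2.1⟩))
      map_smul' := fun c x => by
        rw [RingHom.id_apply, ← S.map_smul]
        exact congrArg S (Subtype.ext (T.map_smul c ⟨x, x.2.1⟩)) }

theorem mem_mul_domain (S T : H →ₗ.[ℂ] H) (x : H) :
    x ∈ (mul S T).domain ↔ ∃ h : x ∈ T.domain, T ⟨x, h⟩ ∈ S.domain :=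
  Iff.rfl

theorem mul_apply (S T : H →ₗ.[ℂ] H) (x : (mul S T).domain) :
    mul S T x = S ⟨T ⟨x, x.2.1⟩, x.2.2⟩ :=
  rfl

/-- A bounded operator, regarded as an operator with domain the whole space. -/
def ofBounded (B : H →L[ℂ] H) : H →ₗ.[ℂ] H :=
  (B : H →ₗ[ℂ] H).toPMap ⊤

/-- The numerical range `{(T u, u) : u ∈ dom T, ‖u‖ = 1}`. Mathlib's inner product is linear in
its second argument, so `(x, y)` is `⟪y, x⟫_ℂ`. -/
def numericalRange (T : H →ₗ.[ℂ] H) : Set ℂ :=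
  {c | ∃ u : T.domain, ‖(u : H)‖ = 1 ∧ c = ⟪(u : H), T u⟫_ℂ}

/-- The operator is accretive: its numerical range lies in the closed right half-plane. -/
def IsAccretive (T : H →ₗ.[ℂ] H) : Prop :=
  numericalRange T ⊆ {c : ℂ | 0 ≤ c.re}

/-- `m`-accretive: accretive, densely defined, and `ran (T - lam I)` is the whole space for some
`lam` with negative real part. -/
def IsMAccretive (T : H →ₗ.[ℂ] H) : Prop :=
  IsAccretive T ∧ Dense (T.domain : Set H) ∧
    ∃ lam : ℂ, lam.re < 0 ∧ ∀ y : H, ∃ x : T.domain, T x - lam • (x : H) = y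

/-- The closed sector with vertex `0` and semi-angle `α` around the positive real axis
(it contains `0`, since `Complex.arg 0 = 0`). -/
def closedSector (α : ℝ) : Set ℂ :=
  {c | |c.arg| ≤ α}

/-- `m`-sectorial (with vertex `0`): `m`-accretive, with numerical range in a closed sector of
some semi-angle `α ∈ [0, π/2)`. -/
def IsMSectorial (T : H →ₗ.[ℂ] H) : Prop :=
  (∃ α : ℝ, 0 ≤ α ∧ α < Real.pi / 2 ∧ numericalRange T ⊆ closedSector α) ∧ IsMAccretive T

/-- The sesquilinear form `a`, with domain the subspace `D` (linear in the first argument,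
conjugate-linear in the second), is sectorial: its values `a[u, u]`, `‖u‖ = 1`, lie in a closed
sector with some real vertex `γ` and some semi-angle `α ∈ [0, π/2)`. -/
def IsSectorialForm (D : Submodule ℂ H) (a : D →ₗ[ℂ] D →ₗ⋆[ℂ] ℂ) : Prop :=
  ∃ γ α : ℝ, 0 ≤ α ∧ α < Real.pi / 2 ∧
    ∀ u : D, ‖(u : H)‖ = 1 → a u u - (γ : ℂ) ∈ closedSector α

/-- The form `a` with domain `D` is closed: if `u n ∈ D`, `u n → x` in the space and
`a[u n - u m, u n - u m] → 0`, then `x ∈ D` and `a[u n - x, u n - x] → 0`. -/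
def IsClosedForm (D : Submodule ℂ H) (a : D →ₗ[ℂ] D →ₗ⋆[ℂ] ℂ) : Prop :=
  ∀ (u : ℕ → D) (x : H),
    Filter.Tendsto (fun n => (u n : H)) Filter.atTop (nhds x) →
    Filter.Tendsto (fun p : ℕ × ℕ => a (u p.1 - u p.2) (u p.1 - u p.2)) Filter.atTop (nhds 0) →
    ∃ hx : x ∈ D,
      Filter.Tendsto (fun n => a (u n - ⟨x, hx⟩) (u n - ⟨x, hx⟩)) Filter.atTop (nhds 0)

/-- `T` is the operator associated with the form `a` in the first representation theorem:
`u ∈ dom T` and `T u = w` if and only if `u ∈ D` and `a[u, v] = (w, v)` for all `v ∈ D`. -/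
def IsAssociatedOperator (D : Submodule ℂ H) (a : D →ₗ[ℂ] D →ₗ⋆[ℂ] ℂ) (T : H →ₗ.[ℂ] H) : Prop :=
  ∀ u w : H, (u, w) ∈ T.graph ↔ ∃ hu : u ∈ D, ∀ v : D, a ⟨u, hu⟩ v = ⟪(v : H), w⟫_ℂ

/-- The family of forms `a z`, `z ∈ Ω`, is holomorphic of type (a): the forms are sectorial and
closed, with a common dense domain `D`, and `z ↦ a z [u, u]` is holomorphic in the domain `Ω`
for every `u ∈ D`. -/
structure IsHolomorphicFormFamily (Ω : Set ℂ) (D : Submodule ℂ H)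
    (a : ℂ → D →ₗ[ℂ] D →ₗ⋆[ℂ] ℂ) : Prop where
  isOpen : IsOpen Ω
  isConnected : IsConnected Ω
  dense : Dense (D : Set H)
  sectorial : ∀ z ∈ Ω, IsSectorialForm D (a z)
  closed : ∀ z ∈ Ω, IsClosedForm D (a z)
  holomorphic : ∀ u : D, DifferentiableOn ℂ (fun z => a z u u) Ω

/-- The family of operators `T z`, `z ∈ Ω`, is holomorphic of type (B): the `T z` are the
operators associated with a holomorphic family of forms of type (a). -/
def IsHolomorphicTypeB (Ω : Set ℂ) (T : ℂ → H →ₗ.[ℂ] H) : Prop :=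
  ∃ (D : Submodule ℂ H) (a : ℂ → D →ₗ[ℂ] D →ₗ⋆[ℂ] ℂ),
    IsHolomorphicFormFamily Ω D a ∧ ∀ z ∈ Ω, IsAssociatedOperator D (a z) (T z)

/-- The operator `L (I + z G) L` on its natural domain
`{h ∈ dom L : (I + z G) L h ∈ dom L}`. -/
def Lam (L : H →ₗ.[ℂ] H) (G : H →L[ℂ] H) (z : ℂ) : H →ₗ.[ℂ] H :=
  mul L (mul (ofBounded (ContinuousLinearMap.id ℂ H + z • G)) L)

theorem mem_Lam_domain (L : H →ₗ.[ℂ] H) (G : H →L[ℂ] H) (z : ℂ) (h : H) :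
    h ∈ (Lam L G z).domain ↔
      ∃ hh : h ∈ L.domain, L ⟨h, hh⟩ + z • G (L ⟨h, hh⟩) ∈ L.domain :=
  ⟨fun ⟨⟨h1, _⟩, h2⟩ => ⟨h1, h2⟩, fun ⟨h1, h2⟩ => ⟨⟨h1, trivial⟩, h2⟩⟩

end UnboundedOperator

namespace UnboundedOperator

open scoped ComplexConjugate
open Filter Topology

variable {H : Type*} [NormedAddCommGroup H] [InnerProductSpace ℂ H]

/-! Since `L` is its own adjoint, `Lam L G z` is the operator of the form `a(z)[u, v] = ((I + zG)Lu,
Lv)` on `dom L`. As `G ≥ 0` and `Re z ≥ 0`, `Re a(z)[u, u] ≥ ‖Lu‖²` and `|Im a(z)[u, u]| ≤ |Im z|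
‖G‖ Re a(z)[u, u]`. Hence the form is sectorial, it is closed because `L` is, and it is affine in
`z`; Lax–Milgram gives the range condition. If `h` lies in the domains for `ξ ≠ μ`, subtraction puts
`(ξ - μ) G L h` in `dom L`, so `G L h = 0` and `h = 0`. The adjoint case reduces to this one with `μ
= conj z`, by `adjoint_Lam_domain_le`. -/

/-- A complex number with `|Im c| ≤ k Re c` lies in the closed sector of semi-angle `arctan k`. -/
theorem mem_closedSector_arctan {c : ℂ} {k : ℝ} (hk : 0 ≤ k) (h : |c.im| ≤ k * c.re) (hc : 0 ≤ c.re) :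
    c ∈ closedSector (Real.arctan k) := by
  rcases hc.eq_or_lt with h0 | h0
  · have him : c.im = 0 := abs_nonpos_iff.1 (by simpa [← h0] using h)
    have : c = 0 := Complex.ext h0.symm him
    simpa [closedSector, this] using hk
  · have hlt := Complex.abs_arg_lt_pi_div_two_iff.2 (Or.inl h0)
    rw [abs_lt] at hlt
    have harg : c.arg = Real.arctan (c.im / c.re) := by
      rw [← Complex.tan_arg, Real.arctan_tan hlt.1 hlt.2]
    rw [abs_le] at h
    rw [closedSector, Set.mem_ofPred_eq, harg, abs_le, ← Real.arctan_neg]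
    refine ⟨Real.arctan_strictMono.monotone ?_, Real.arctan_strictMono.monotone ?_⟩
    · rw [le_div_iff₀ h0]; linarith [h.1]
    · rw [div_le_iff₀ h0]; exact h.2

/-! ### The form behind `Lam` -/

variable {L : H →ₗ.[ℂ] H} {G : H →L[ℂ] H} {z : ℂ}

theorem mem_graph_iff_inner [CompleteSpace H] (hL : IsSelfAdjoint L) (x y : H) :
    (x, y) ∈ L.graph ↔ ∀ v : L.domain, ⟪L v, x⟫_ℂ = ⟪(v : H), y⟫_ℂ := by
  have hg := L.adjoint_graph_eq_graph_adjoint hL.dense_domain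
  rw [LinearPMap.isSelfAdjoint_def.1 hL] at hg
  rw [hg, Submodule.mem_adjoint_iff]
  simp only [sub_eq_zero]
  exact ⟨fun h v => h _ _ (L.mem_graph v), fun h a b hab => by
    obtain ⟨v, rfl, rfl⟩ := L.mem_graph_iff.1 hab
    exact h v⟩

theorem mem_Lam_graph (u w : H) :
    (u, w) ∈ (Lam L G z).graph ↔
      ∃ hu : u ∈ L.domain, (L ⟨u, hu⟩ + z • G (L ⟨u, hu⟩), w) ∈ L.graph := by
  constructor
  · intro h
    obtain ⟨x, rfl, rfl⟩ := LinearPMap.mem_graph_iff _ |>.1 h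
    exact ⟨x.2.1.1, L.mem_graph ⟨_, x.2.2⟩⟩
  · rintro ⟨hu, h⟩
    obtain ⟨y, hy, rfl⟩ := L.mem_graph_iff.1 h
    refine (LinearPMap.mem_graph_iff _).2 ⟨⟨u, (mem_Lam_domain L G z u).2 ⟨hu, ?_⟩⟩, rfl, ?_⟩
    · have hy2 := y.2
      rwa [hy] at hy2
    · exact congrArg L (Subtype.ext hy.symm)

variable (L G z) in
/-- The sesquilinear form `((I + z G) L u, L v)` with domain `dom L`. -/
noncomputable def lamForm : L.domain →ₗ[ℂ] L.domain →ₗ⋆[ℂ] ℂ :=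
  LinearMap.mk₂'ₛₗ _ _ (fun u v => ⟪L v, L u + z • G (L u)⟫_ℂ)
    (fun u u' v => by simp only [L.map_add, map_add, smul_add, inner_add_right]; ring)
    (fun c u v => by
      simp only [L.map_smul, map_smul, inner_add_right, inner_smul_right, smul_eq_mul,
        RingHom.id_apply]
      ring)
    (fun u v v' => by simp only [L.map_add, inner_add_left])
    (fun c u v => by simp only [L.map_smul, inner_smul_left, smul_eq_mul])

theorem lamForm_apply (u v : L.domain) :
    lamForm L G z u v = ⟪L v, L u + z • G (L u)⟫_ℂ :=
  rfl

theorem isAssociatedOperator_lamForm [CompleteSpace H] (hL : IsSelfAdjoint L) :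
    IsAssociatedOperator L.domain (lamForm L G z) (Lam L G z) := fun u w => by
  simp only [mem_Lam_graph, mem_graph_iff_inner hL, lamForm_apply]

theorem inner_add_smul_re_im (hG : G.IsPositive) (x : H) :
    (⟪x, x + z • G x⟫_ℂ).re = ‖x‖ ^ 2 + z.re * (⟪x, G x⟫_ℂ).re ∧
      (⟪x, x + z • G x⟫_ℂ).im = z.im * (⟪x, G x⟫_ℂ).re := by
  have him : (⟪x, G x⟫_ℂ).im = 0 := ((Complex.nonneg_iff.1 (hG.inner_nonneg_right x)).2).symm
  have hx : ⟪x, x⟫_ℂ = ((‖x‖ ^ 2 : ℝ) : ℂ) := by simp [inner_self_eq_norm_sq_to_K]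
  rw [inner_add_right, inner_smul_right, hx]
  constructor <;> simp [-Complex.ofReal_pow, him]

theorem norm_sq_le_re_inner_add_smul (hG : G.IsPositive) (hz : 0 ≤ z.re) (x : H) :
    ‖x‖ ^ 2 ≤ (⟪x, x + z • G x⟫_ℂ).re := by
  rw [(inner_add_smul_re_im hG x).1]
  have := (Complex.nonneg_iff.1 (hG.inner_nonneg_right x)).1
  nlinarith [mul_nonneg hz this]

theorem abs_im_inner_add_smul_le (hG : G.IsPositive) (hz : 0 ≤ z.re) (x : H) :
    |(⟪x, x + z • G x⟫_ℂ).im| ≤ |z.im| * ‖G‖ * (⟪x, x + z • G x⟫_ℂ).re := by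
  have h0 := (Complex.nonneg_iff.1 (hG.inner_nonneg_right x)).1
  have h1 : (⟪x, G x⟫_ℂ).re ≤ ‖G‖ * ‖x‖ ^ 2 := calc
    (⟪x, G x⟫_ℂ).re ≤ ‖⟪x, G x⟫_ℂ‖ := Complex.re_le_norm _
    _ ≤ ‖x‖ * ‖G x‖ := norm_inner_le_norm _ _
    _ ≤ ‖x‖ * (‖G‖ * ‖x‖) := by gcongr; exact G.le_opNorm x
    _ = ‖G‖ * ‖x‖ ^ 2 := by ring
  rw [(inner_add_smul_re_im hG x).2, abs_mul, abs_of_nonneg h0, mul_assoc]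
  gcongr
  refine h1.trans ?_
  gcongr
  exact norm_sq_le_re_inner_add_smul hG hz x

theorem inner_add_smul_mem_closedSector (hG : G.IsPositive) (hz : 0 ≤ z.re) (x : H) :
    ⟪x, x + z • G x⟫_ℂ ∈ closedSector (Real.arctan (|z.im| * ‖G‖)) :=
  mem_closedSector_arctan (by positivity) (abs_im_inner_add_smul_le hG hz x)
    ((sq_nonneg _).trans (norm_sq_le_re_inner_add_smul hG hz x))

theorem isSectorialForm_lamForm (hG : G.IsPositive) (hz : 0 ≤ z.re) :
    IsSectorialForm L.domain (lamForm L G z) :=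
  ⟨0, _, Real.arctan_nonneg.2 (by positivity), Real.arctan_lt_pi_div_two (|z.im| * ‖G‖),
    fun u _ => by
      simpa [lamForm_apply] using inner_add_smul_mem_closedSector hG hz (L u)⟩

theorem isClosedForm_lamForm [CompleteSpace H] (hL : IsSelfAdjoint L) (hG : G.IsPositive)
    (hz : 0 ≤ z.re) : IsClosedForm L.domain (lamForm L G z) := by
  intro u x hu ha
  -- The real part of the form dominates `‖L ·‖²`, so form-Cauchy sequences are Cauchy in the graph
  -- norm.
  have hL0 : Tendsto (fun p : ℕ × ℕ => ‖L (u p.1) - L (u p.2)‖ ^ 2) atTop (𝓝 0) := by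
    have hre := (Complex.continuous_re.tendsto 0).comp ha
    rw [Complex.zero_re] at hre
    refine squeeze_zero (fun _ => by positivity) (fun p => ?_) hre
    rw [← L.map_sub]
    exact norm_sq_le_re_inner_add_smul hG hz _
  have hcau : CauchySeq (fun n => L (u n)) := by
    rw [cauchySeq_iff_tendsto_dist_atTop_0]
    have := (Real.continuous_sqrt.tendsto 0).comp hL0
    simpa [Function.comp_def, dist_eq_norm] using this
  obtain ⟨y, hy⟩ := cauchySeq_tendsto_of_complete hcau
  have hxy : (x, y) ∈ L.graph :=
    hL.isClosed.mem_of_tendsto (hu.prodMk_nhds hy) (Eventually.of_forall fun n => L.mem_graph (u n))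
  have hx : x ∈ L.domain := LinearPMap.mem_domain_of_mem_graph hxy
  obtain rfl : y = L ⟨x, hx⟩ := (LinearPMap.image_iff hx).2 hxy
  refine ⟨hx, ?_⟩
  have hsub : Tendsto (fun n => L (u n - ⟨x, hx⟩)) atTop (𝓝 0) := by
    simpa [LinearPMap.map_sub] using hy.sub_const (L ⟨x, hx⟩)
  have hcont : Continuous fun y : H => ⟪y, y + z • G y⟫_ℂ := by fun_prop
  have h0 := (hcont.tendsto 0).comp hsub
  rwa [inner_zero_left] at h0

theorem isHolomorphicTypeB_Lam [CompleteSpace H] (hL : IsSelfAdjoint L) (hG : G.IsPositive) :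
    IsHolomorphicTypeB {z : ℂ | 0 < z.re} (Lam L G) :=
  ⟨L.domain, fun z => lamForm L G z,
    { isOpen := isOpen_lt continuous_const Complex.continuous_re
      isConnected := ⟨⟨1, by simp⟩, (convex_halfSpace_re_gt 0).isPreconnected⟩
      dense := hL.dense_domain
      sectorial := fun _ hz => isSectorialForm_lamForm hG (le_of_lt hz)
      closed := fun _ hz => isClosedForm_lamForm hL hG (le_of_lt hz)
      holomorphic := fun u => by
        simp only [lamForm_apply, inner_add_right, inner_smul_right]
        fun_prop },
    fun _ _ => isAssociatedOperator_lamForm hL⟩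

/-! ### Range, density and m-sectoriality -/

theorem inner_Lam_apply [CompleteSpace H] (hL : IsSelfAdjoint L) (u : (Lam L G z).domain)
    (v : L.domain) : ⟪(v : H), Lam L G z u⟫_ℂ =
      ⟪L v, L ⟨u, u.2.1.1⟩ + z • G (L ⟨u, u.2.1.1⟩)⟫_ℂ :=
  (((isAssociatedOperator_lamForm hL _ _).1 (LinearPMap.mem_graph _ u)).2 v).symm

theorem inner_Lam_apply_self [CompleteSpace H] (hL : IsSelfAdjoint L) (u : (Lam L G z).domain) :
    ⟪(u : H), Lam L G z u⟫_ℂ =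
      ⟪L ⟨u, u.2.1.1⟩, L ⟨u, u.2.1.1⟩ + z • G (L ⟨u, u.2.1.1⟩)⟫_ℂ :=
  inner_Lam_apply hL u ⟨u, u.2.1.1⟩

/-- Lax–Milgram on `dom L` with the graph norm, realised as the closed subspace `K` of the Hilbert
sum `H ⊕ H`. -/
theorem exists_Lam_add_self_eq [CompleteSpace H] (hL : IsSelfAdjoint L) (hG : G.IsPositive)
    (hz : 0 ≤ z.re) (y : H) : ∃ x : (Lam L G z).domain, Lam L G z x + x = y := by
  let K : Submodule ℂ (WithLp 2 (H × H)) :=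
    L.graph.comap (WithLp.linearEquiv 2 ℂ (H × H)).toLinearMap
  have hK : IsClosed (K : Set (WithLp 2 (H × H))) :=
    hL.isClosed.preimage (WithLp.prod_continuous_ofLp 2 H H)
  have : CompleteSpace K := hK.completeSpace_coe
  let F : K →L[ℂ] H := (WithLp.fstL 2 ℂ H H).comp K.subtypeL
  let P : K →L[ℂ] H := (WithLp.sndL 2 ℂ H H).comp K.subtypeL
  have hFP (k : K) : (F k, P k) ∈ L.graph := k.2
  have hnorm (k : K) : ‖k‖ ^ 2 = ‖F k‖ ^ 2 + ‖P k‖ ^ 2 :=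
    WithLp.prod_norm_sq_eq_of_L2 (k : WithLp 2 (H × H))
  -- `T` represents `a(z)[u, v] + (u, v)` on `K`; its real part is at least `‖k‖²`, whence the
  -- constant `1` below.
  let T : K →L[ℂ] K := F.adjoint.comp F +
    P.adjoint.comp ((ContinuousLinearMap.id ℂ H + z • G).comp P)
  have hT (v u : K) : ⟪v, T u⟫_ℂ = ⟪F v, F u⟫_ℂ + ⟪P v, P u + z • G (P u)⟫_ℂ := by
    simp [T, ContinuousLinearMap.adjoint_inner_right]
  have hunit : IsUnit T := by
    refine T.isUnit_of_forall_le_norm_inner_map (c := 1) one_pos fun k => ?_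
    rw [norm_inner_symm, NNReal.coe_one, mul_one]
    refine le_trans ?_ (Complex.re_le_norm _)
    have hF : (⟪F k, F k⟫_ℂ).re = ‖F k‖ ^ 2 := (norm_sq_eq_re_inner (𝕜 := ℂ) _).symm
    rw [hT, Complex.add_re, hF, hnorm]
    gcongr
    exact norm_sq_le_re_inner_add_smul hG hz _
  -- `F.adjoint y` represents the functional `v ↦ (y, v)` on `K`.
  obtain ⟨u, hu⟩ := (ContinuousLinearMap.isUnit_iff_bijective.1 hunit).2 (F.adjoint y)
  have huL : F u ∈ L.domain := LinearPMap.mem_domain_of_mem_graph (hFP u)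
  have hPu : P u = L ⟨F u, huL⟩ := (LinearPMap.image_iff huL).2 (hFP u)
  have hmem : (F u, y - F u) ∈ (Lam L G z).graph := by
    refine (isAssociatedOperator_lamForm hL _ _).2 ⟨huL, fun v => ?_⟩
    let k : K := ⟨WithLp.toLp 2 ((v : H), L v), L.mem_graph v⟩
    have h := hT k u
    rw [hu, ContinuousLinearMap.adjoint_inner_right, hPu] at h
    rw [lamForm_apply, inner_sub_right]
    exact eq_sub_of_add_eq' h.symm
  obtain ⟨x, hx, hx'⟩ := (LinearPMap.mem_graph_iff _).1 hmem
  exact ⟨x, by rw [hx', hx]; exact sub_add_cancel _ _⟩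

/-- A vector `Λx + x` orthogonal to the domain, tested against `x` itself, forces `‖x‖² + Re a(z)[x,
x] = 0`. -/
theorem dense_domain_Lam [CompleteSpace H] (hL : IsSelfAdjoint L) (hG : G.IsPositive)
    (hz : 0 ≤ z.re) : Dense ((Lam L G z).domain : Set H) := by
  rw [Submodule.dense_iff_topologicalClosure_eq_top, Submodule.topologicalClosure_eq_top_iff,
    Submodule.eq_bot_iff]
  intro f hf
  obtain ⟨x, rfl⟩ := exists_Lam_add_self_eq hL hG hz f
  have h := congrArg Complex.re (hf x x.2)
  have hx : (⟪(x : H), (x : H)⟫_ℂ).re = ‖(x : H)‖ ^ 2 := (norm_sq_eq_re_inner (𝕜 := ℂ) _).symm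
  rw [inner_add_right, inner_Lam_apply_self hL, Complex.add_re, hx, Complex.zero_re] at h
  have h1 := norm_sq_le_re_inner_add_smul hG hz (L ⟨x, x.2.1.1⟩)
  have h2 : ‖(x : H)‖ ^ 2 = 0 := by
    linarith [sq_nonneg ‖(x : H)‖, sq_nonneg ‖L ⟨x, x.2.1.1⟩‖]
  have h3 : x = 0 := Subtype.ext (by simpa using h2)
  simp [h3]

theorem isMSectorial_Lam [CompleteSpace H] (hL : IsSelfAdjoint L) (hG : G.IsPositive)
    (hz : 0 ≤ z.re) : IsMSectorial (Lam L G z) := by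
  refine ⟨⟨_, Real.arctan_nonneg.2 (by positivity), Real.arctan_lt_pi_div_two (|z.im| * ‖G‖), ?_⟩,
    ?_, dense_domain_Lam hL hG hz, -1, by simp, fun y => ?_⟩
  · rintro _ ⟨u, -, rfl⟩
    rw [inner_Lam_apply_self hL]
    exact inner_add_smul_mem_closedSector hG hz _
  · rintro _ ⟨u, -, rfl⟩
    rw [inner_Lam_apply_self hL]
    exact (sq_nonneg _).trans (norm_sq_le_re_inner_add_smul hG hz _)
  · obtain ⟨x, hx⟩ := exists_Lam_add_self_eq hL hG hz y
    exact ⟨x, by simpa using hx⟩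

/-! ### Intersections of domains -/

theorem Lam_domain_inter_eq_zero (hL_ker : ∀ x : L.domain, L x = 0 → (x : H) = 0)
    (hG_ker : ∀ x : H, G x = 0 → x = 0)
    (hGL : Set.range G ∩ (L.domain : Set H) = {0}) {ξ μ : ℂ} (h : ξ ≠ μ) :
    ((Lam L G ξ).domain : Set H) ∩ ((Lam L G μ).domain : Set H) = {0} := by
  refine Set.Subset.antisymm ?_ (Set.singleton_subset_iff.2 ⟨Submodule.zero_mem _,
    Submodule.zero_mem _⟩)
  rintro x ⟨hξ, hμ⟩
  obtain ⟨hx, hξ⟩ := (mem_Lam_domain L G ξ x).1 hξ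
  obtain ⟨_, hμ⟩ := (mem_Lam_domain L G μ x).1 hμ
  have hd : (ξ - μ) • G (L ⟨x, hx⟩) ∈ L.domain := by
    convert L.domain.sub_mem hξ hμ using 1
    rw [sub_smul]; abel
  have hGx : G (L ⟨x, hx⟩) ∈ L.domain := (L.domain.smul_mem_iff (sub_ne_zero.2 h)).1 hd
  have h0 : G (L ⟨x, hx⟩) ∈ ({0} : Set H) := hGL ▸ ⟨⟨_, rfl⟩, hGx⟩
  exact hL_ker _ (hG_ker _ h0)

theorem inner_Lam_conj [CompleteSpace H] (hL : IsSelfAdjoint L) (hG : G.IsPositive)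
    (x : (Lam L G z).domain) (u : (Lam L G (conj z)).domain) :
    ⟪Lam L G (conj z) u, (x : H)⟫_ℂ = ⟪(u : H), Lam L G z x⟫_ℂ := by
  rw [← inner_conj_symm, inner_Lam_apply hL u ⟨x, x.2.1.1⟩, inner_conj_symm,
    inner_Lam_apply hL x ⟨u, u.2.1.1⟩, inner_add_left, inner_add_right, inner_smul_left,
    inner_smul_right, Complex.conj_conj, hG.inner_left_eq_inner_right]

/-- `Λ(conj z) + I` is onto and is contained in `Λ(z)* + I`, which is injective because `Λ(z) + I`
is onto; so the two coincide. -/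
theorem adjoint_Lam_domain_le [CompleteSpace H] (hL : IsSelfAdjoint L) (hG : G.IsPositive)
    (hz : 0 ≤ z.re) : (Lam L G z).adjoint.domain ≤ (Lam L G (conj z)).domain := by
  intro y hy
  have hadj (x : (Lam L G z).domain) :
      ⟪(Lam L G z).adjoint ⟨y, hy⟩, (x : H)⟫_ℂ = ⟪y, Lam L G z x⟫_ℂ :=
    LinearPMap.adjoint_isFormalAdjoint (dense_domain_Lam hL hG hz) ⟨y, hy⟩ x
  obtain ⟨u, hu⟩ := exists_Lam_add_self_eq (z := conj z) hL hG (by simpa using hz)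
    ((Lam L G z).adjoint ⟨y, hy⟩ + y)
  -- `u - y` is orthogonal to the range of `Λ(z) + I`, which is all of `H`.
  have key (x : (Lam L G z).domain) : ⟪(u : H) - y, Lam L G z x + x⟫_ℂ = 0 := by
    have h := congrArg (fun w => ⟪w, (x : H)⟫_ℂ) hu
    simp only [inner_add_left] at h
    rw [inner_Lam_conj hL hG, hadj] at h
    rw [inner_sub_left, inner_add_right, inner_add_right, h, sub_self]
  obtain ⟨x, hx⟩ := exists_Lam_add_self_eq hL hG hz ((u : H) - y)
  have h0 := key x
  rw [hx, inner_self_eq_zero, sub_eq_zero] at h0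
  exact h0 ▸ u.2

end UnboundedOperator

theorem theorem10p1 {H : Type*} [NormedAddCommGroup H] [InnerProductSpace ℂ H] [CompleteSpace H]
    (L : H →ₗ.[ℂ] H) (hL : IsSelfAdjoint L)
    (hL_nonneg : ∀ x : L.domain, 0 ≤ (⟪(x : H), L x⟫_ℂ).re)
    (hL_ker : ∀ x : L.domain, L x = 0 → (x : H) = 0)
    (G : H →L[ℂ] H) (hG : G.IsPositive)
    (hG_ker : ∀ x : H, G x = 0 → x = 0)
    (hGL : Set.range G ∩ (L.domain : Set H) = {0}) :
    (∀ z : ℂ, 0 ≤ z.re → UnboundedOperator.IsMSectorial (UnboundedOperator.Lam L G z)) ∧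
    UnboundedOperator.IsHolomorphicTypeB {z : ℂ | 0 < z.re} (UnboundedOperator.Lam L G) ∧
    (∀ ξ μ : ℂ, 0 ≤ ξ.re → 0 ≤ μ.re → ξ ≠ μ →
      ((UnboundedOperator.Lam L G ξ).domain : Set H) ∩
        ((UnboundedOperator.Lam L G μ).domain : Set H) = {0}) ∧
    (∀ z : ℂ, 0 ≤ z.re → z.im ≠ 0 →
      ((UnboundedOperator.Lam L G z).domain : Set H) ∩
        ((UnboundedOperator.Lam L G z).adjoint.domain : Set H) = {0}) := by
  refine ⟨fun z hz => UnboundedOperator.isMSectorial_Lam hL hG hz,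
    UnboundedOperator.isHolomorphicTypeB_Lam hL hG,
    fun ξ μ _ _ h => UnboundedOperator.Lam_domain_inter_eq_zero hL_ker hG_ker hGL h,
    fun z hz him => Set.Subset.antisymm ?_ (Set.singleton_subset_iff.2
      ⟨Submodule.zero_mem _, Submodule.zero_mem _⟩)⟩
  have hne : z ≠ starRingEnd ℂ z := fun h => him (Complex.conj_eq_iff_im.1 h.symm)
  rw [← UnboundedOperator.Lam_domain_inter_eq_zero hL_ker hG_ker hGL hne]
  exact Set.inter_subset_inter_right _ (UnboundedOperator.adjoint_Lam_domain_le hL hG hz)
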